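/- Let $\mathcal H$ be a right linear quaternionic Hilbert space (with $\mathbb H$-valued inner product that is right linear in the first variable and conjugate symmetric), and let $\mathcal B(\mathcal H)$ be the set of everywhere defined bounded right linear operators on $\mathcal H$. Sums, products and inverses of operators are taken on their natural domains. The adjoint $T^*$ of a densely defined operator $T$ is given by $\langle Tx,y\rangle=\langle x,T^*y\rangle$ for $x\in\mathcal D(T)$, with $\mathcal D(T^*)$ the set of all $y$ for which there is a $z$ with $\langle Tx,y\rangle=\langle x,z\rangle$ for all $x\in\mathcal D(T)$. An operator $T$ is called positive if $\langle Tx,x\rangle\in[0,\infty)$ for all $x\in\mathcal D(T)$, and normal if it is densely defined, closed and $TT^*=T^*T$ (including equality of domains). Let $T:\mathcal D(T)\to\mathcal H$, $\mathcal D(T)\subseteq\mathcal H$, be a densely defined closed right linear operator. Then $T^*$ is densely defined and closed, $I+T^*T$ is injective, $C_T:=(I+T^*T)^{-1}$ is a positive operator in $\mathcal B(\mathcal H)$, and there is exactly one positive $W\in\mathcal B(\mathcal H)$ with $W^2=C_T$. Write $C_T^{1/2}:=W$ and $Z_T:=T\,C_T^{1/2}$ (and define $Z_{T^*}$ in the same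 way from $T^*$). Then: (i) $Z_T\in\mathcal B(\mathcal H)$, $\|Z_T\|\le 1$, and $C_T=(I+T^*T)^{-1}=I-Z_T^*Z_T$. (ii) $(Z_T)^*=Z_{T^*}$. (iii) If $T$ is normal, then $Z_T$ is normal. -/

import Mathlib

open scoped Quaternion

/-- A right linear quaternionic inner product space. The right scalar multiplication `x α` is
`MulOpposite.op α • x`, so right linear maps are the `ℍᵐᵒᵖ`-linear ones. The inner product is
`ℍ`-valued, right linear in the first variable, and induces the given norm. A quaternionic
Hilbert space is such a space which is moreover complete. -/
class RightQuaternionicInnerProductSpace (H : Type*) [NormedAddCommGroup H] extends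
    Module ℍᵐᵒᵖ H, Inner ℍ H where
  star_inner : ∀ x y : H, star (inner y x) = inner x y
  inner_self : ∀ x : H, inner x x = ((‖x‖ ^ 2 : ℝ) : ℍ)
  inner_add_left : ∀ x y z : H, inner (x + y) z = inner x z + inner y z
  inner_smul_left : ∀ (x y : H) (α : ℍ), inner (MulOpposite.op α • x) y = inner x y * α

namespace QuaternionicOp

variable {H : Type*} [NormedAddCommGroup H] [RightQuaternionicInnerProductSpace H]

theorem inner_add_right (x y z : H) : inner ℍ x (y + z) = inner ℍ x y + inner ℍ x z := by
  simp only [← RightQuaternionicInnerProductSpace.star_inner x,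
    RightQuaternionicInnerProductSpace.inner_add_left, star_add]

theorem inner_smul_right (x y : H) (α : ℍ) :
    inner ℍ x (MulOpposite.op α • y) = star α * inner ℍ x y := by
  simp only [← RightQuaternionicInnerProductSpace.star_inner x,
    RightQuaternionicInnerProductSpace.inner_smul_left, star_mul]

theorem inner_zero_right (x : H) : inner ℍ x (0 : H) = 0 := by
  simpa using inner_smul_right x 0 0

/-- A right linear operator is closed if its graph is a closed subset of `H × H`. -/
def IsClosedOp (T : H →ₗ.[ℍᵐᵒᵖ] H) : Prop :=
  IsClosed (T.graph : Set (H × H))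

/-- The everywhere defined identity operator. -/
noncomputable def idOp : H →ₗ.[ℍᵐᵒᵖ] H :=
  (LinearMap.id : H →ₗ[ℍᵐᵒᵖ] H).toPMap ⊤

/-- The product `S T` of two operators, on its natural domain `{x ∈ D(T) : T x ∈ D(S)}`. -/
noncomputable def mulOp (S T : H →ₗ.[ℍᵐᵒᵖ] H) : H →ₗ.[ℍᵐᵒᵖ] H where
  domain :=
    { carrier := {x | ∃ h : x ∈ T.domain, T ⟨x, h⟩ ∈ S.domain}
      zero_mem' := ⟨T.domain.zero_mem, by
        have : T ⟨0, T.domain.zero_mem⟩ = 0 := T.map_zero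
        rw [this]; exact S.domain.zero_mem⟩
      add_mem' := by
        rintro x y ⟨hx, hx'⟩ ⟨hy, hy'⟩
        refine ⟨T.domain.add_mem hx hy, ?_⟩
        have : T ⟨x + y, T.domain.add_mem hx hy⟩ = T ⟨x, hx⟩ + T ⟨y, hy⟩ :=
          T.map_add ⟨x, hx⟩ ⟨y, hy⟩
        rw [this]; exact S.domain.add_mem hx' hy'
      smul_mem' := by
        rintro c x ⟨hx, hx'⟩
        refine ⟨T.domain.smul_mem c hx, ?_⟩
        have : T ⟨c • x, T.domain.smul_mem c hx⟩ = c • T ⟨x, hx⟩ := T.map_smul c ⟨x, hx⟩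
        rw [this]; exact S.domain.smul_mem c hx' }
  toFun :=
    { toFun := fun x => S ⟨T ⟨x.1, x.2.choose⟩, x.2.choose_spec⟩
      map_add' := fun x y => by
        rw [← S.map_add]
        congr 1
        exact Subtype.ext (T.map_add ⟨x.1, x.2.choose⟩ ⟨y.1, y.2.choose⟩)
      map_smul' := fun c x => by
        rw [RingHom.id_apply, ← S.map_smul]
        congr 1
        exact Subtype.ext (T.map_smul c ⟨x.1, x.2.choose⟩) }

/-- The adjoint relation `{(y, z) : ⟨T x, y⟩ = ⟨x, z⟩ for all x ∈ D(T)}`. -/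
def adjointGraph (T : H →ₗ.[ℍᵐᵒᵖ] H) : Submodule ℍᵐᵒᵖ (H × H) where
  carrier := {p | ∀ x : T.domain, inner ℍ (T x) p.1 = inner ℍ (x : H) p.2}
  zero_mem' := fun x => by simp [inner_zero_right]
  add_mem' := fun {p q} hp hq x => by
    simp only [Prod.fst_add, Prod.snd_add, inner_add_right, hp x, hq x]
  smul_mem' := fun c p hp x => by
    have h1 := inner_smul_right (T x) p.1 c.unop
    have h2 := inner_smul_right (x : H) p.2 c.unop
    rw [MulOpposite.op_unop] at h1 h2
    simp only [Prod.smul_fst, Prod.smul_snd, h1, h2, hp x]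

/-- The adjoint `T*`: its domain is the set of all `y` for which there is a `z` with
`⟨T x, y⟩ = ⟨x, z⟩` for all `x ∈ D(T)`, and `T* y = z`. This is meaningful for densely defined
`T`, see `graph_adjointOp`. -/
noncomputable def adjointOp (T : H →ₗ.[ℍᵐᵒᵖ] H) : H →ₗ.[ℍᵐᵒᵖ] H :=
  (adjointGraph T).toLinearPMap

/-- For densely defined `T` the adjoint relation is the graph of `T*`. -/
theorem graph_adjointOp (T : H →ₗ.[ℍᵐᵒᵖ] H) (hT : Dense (T.domain : Set H)) :
    (adjointOp T).graph = adjointGraph T := by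
  apply Submodule.toLinearPMap_graph_eq
  rintro ⟨y, z⟩ hp (rfl : y = 0)
  change z = 0
  have h0 : ∀ x ∈ T.domain, inner ℍ x z = 0 := fun x hx => by
    have : inner ℍ (T ⟨x, hx⟩) (0 : H) = inner ℍ x z := hp ⟨x, hx⟩
    rw [← this, inner_zero_right]
  have h1 : ∀ x ∈ T.domain, ‖x + z‖ ^ 2 = ‖x‖ ^ 2 + ‖z‖ ^ 2 := fun x hx => by
    have h := RightQuaternionicInnerProductSpace.inner_self (x + z)
    have h' : inner ℍ z x = 0 := by
      rw [← RightQuaternionicInnerProductSpace.star_inner, h0 x hx, star_zero]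
    rw [RightQuaternionicInnerProductSpace.inner_add_left, inner_add_right, inner_add_right,
      h0 x hx, h', RightQuaternionicInnerProductSpace.inner_self,
      RightQuaternionicInnerProductSpace.inner_self, add_zero, zero_add,
      ← Quaternion.coe_add] at h
    exact (Quaternion.coe_injective h).symm
  have h2 : Set.EqOn (fun x : H => ‖x + z‖ ^ 2) (fun x => ‖x‖ ^ 2 + ‖z‖ ^ 2) Set.univ := by
    rw [← hT.closure_eq]
    exact Set.EqOn.closure (fun x hx => h1 x hx) (by fun_prop) (by fun_prop)
  have h3 := h2 (Set.mem_univ (-z))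
  simp only [neg_add_cancel, norm_zero, norm_neg] at h3
  have : ‖z‖ = 0 := by nlinarith [norm_nonneg z]
  exact norm_eq_zero.mp this

/-- The set of all `‖T x‖` with `x ∈ D(T)`, `‖x‖ ≤ 1`. -/
def unitBallNorms (T : H →ₗ.[ℍᵐᵒᵖ] H) : Set ℝ :=
  {r | ∃ x : T.domain, ‖(x : H)‖ ≤ 1 ∧ r = ‖T x‖}

/-- `T ∈ B(H)`: the operator is everywhere defined and bounded. -/
def IsBoundedOp (T : H →ₗ.[ℍᵐᵒᵖ] H) : Prop :=
  T.domain = ⊤ ∧ BddAbove (unitBallNorms T)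

/-- The operator norm `‖T‖ = sup {‖T x‖ : ‖x‖ ≤ 1}`. -/
noncomputable def normOp (T : H →ₗ.[ℍᵐᵒᵖ] H) : ℝ :=
  sSup (unitBallNorms T)

/-- `⟨T x, x⟩` is a nonnegative real number for all `x ∈ D(T)`. -/
def IsPositiveOp (T : H →ₗ.[ℍᵐᵒᵖ] H) : Prop :=
  ∀ x : T.domain, ∃ r : ℝ, 0 ≤ r ∧ inner ℍ (T x) (x : H) = (r : ℍ)

/-- `T` is densely defined, closed, and `T T* = T* T` (with equality of domains). -/
def IsNormalOp (T : H →ₗ.[ℍᵐᵒᵖ] H) : Prop :=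
  Dense (T.domain : Set H) ∧ IsClosedOp T ∧ mulOp T (adjointOp T) = mulOp (adjointOp T) T

/-- `W ∈ B(H)` is a positive operator with `W² = C`. -/
def IsPositiveSqrt (C W : H →ₗ.[ℍᵐᵒᵖ] H) : Prop :=
  IsBoundedOp W ∧ IsPositiveOp W ∧ mulOp W W = C

/-- The operator `C^{1/2}`: the positive square root of `C` in `B(H)`, which is meaningful where
exactly one exists (as it does for positive `C ∈ B(H)`). -/
noncomputable def sqrtOp (C : H →ₗ.[ℍᵐᵒᵖ] H) : H →ₗ.[ℍᵐᵒᵖ] H :=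
  Classical.epsilon (IsPositiveSqrt C)

/-- The operator `I + T* T`, with domain `D(T* T)`. -/
noncomputable def oneAddAdjointMul (T : H →ₗ.[ℍᵐᵒᵖ] H) : H →ₗ.[ℍᵐᵒᵖ] H :=
  idOp + mulOp (adjointOp T) T

/-- The operator `C_T = (I + T* T)⁻¹`, with domain the range of `I + T* T`. -/
noncomputable def cOp (T : H →ₗ.[ℍᵐᵒᵖ] H) : H →ₗ.[ℍᵐᵒᵖ] H :=
  (oneAddAdjointMul T).inverse

/-- The bounded transform `Z_T = T C_T^{1/2}`, on its natural domain. -/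
noncomputable def zOp (T : H →ₗ.[ℍᵐᵒᵖ] H) : H →ₗ.[ℍᵐᵒᵖ] H :=
  mulOp T (sqrtOp (cOp T))

end QuaternionicOp

/-!
Right multiplication by `ℂ ⊆ ℍ` makes `H` a complex Hilbert space with the same norm, whose inner
product is the complex part of the quaternionic one. A quaternion `q` is determined by the complex
parts of its multiples `q α`, so for right linear operators adjoints and positivity mean the same
over `ℍ` and over `ℂ` (`mem_adjointGraph_iff`, `isPositiveOp_toOp_iff`), and Hilbert space theory
over `ℂ` becomes available.

For closed `T` the orthogonal complement of the graph is `{(T* v, -v)}`. Decomposing `(h, 0)` along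
the graph solves `x + T* T x = h`, so `C_T` is everywhere defined; decomposing `(0, b)` shows that
`T*` is densely defined, and decomposing elements of the graph of `T**` shows that `T** = T`
(`exists_graph_decomposition`).

The square root `W` of `C_T` comes from the continuous functional calculus over `ℂ`. Being a norm
limit of real polynomials in `C_T`, it commutes with right multiplication by all of `ℍ`, hence is
right linear; for the same reason an intertwining relation `D C = C' D` implies
`D C^{1/2} = C'^{1/2} D` (`ContinuousLinearMap.map_sqrt_of_intertwines`).

On the range of `W`, which is dense, `‖T W (W x)‖² = ⟨T* T C_T x, C_T x⟩ = ⟨x - C_T x, C_T x⟩` is at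
most `‖W x‖²`; as `T` is closed, `Z_T = T W` is an everywhere defined contraction, and the same
computation gives `Z_T* Z_T = I - C_T`. Next, `C_{T*} T = T C_T` on the range of `C_T` gives
`C_{T*} Z_T = Z_T C_T`, so `C_{T*}^{1/2} Z_T = Z_T C_T^{1/2}`. Taking adjoints,
`Z_T* C_{T*}^{1/2} = (Z_T W)* = (T C_T)* = T* C_{T*} = Z_{T*} C_{T*}^{1/2}`, and the dense range of
`C_{T*}^{1/2}` yields `Z_T* = Z_{T*}`. If `T` is normal then `C_T = C_{T*}`, and the formula for
`Z_T* Z_T` applied to `T` and to `T*` shows that `Z_T` is normal.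
-/

/-! ### The underlying complex Hilbert space -/

namespace QuaternionicOp

open MulOpposite RightQuaternionicInnerProductSpace

/-- The component in `ℂ = ℝ + ℝ i` of a quaternion, along the decomposition `ℍ = ℂ ⊕ ℂ j`. -/
def complexPart : ℍ →ₗ[ℝ] ℂ where
  toFun q := ⟨q.re, q.imI⟩
  map_add' _ _ := by apply Complex.ext <;> simp
  map_smul' _ _ := by apply Complex.ext <;> simp

theorem complexPart_re (q : ℍ) : (complexPart q).re = q.re := rfl

theorem complexPart_im (q : ℍ) : (complexPart q).im = q.imI := rfl

theorem complexPart_star (q : ℍ) : complexPart (star q) = star (complexPart q) := by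
  apply Complex.ext <;> simp [complexPart_re, complexPart_im]

theorem complexPart_mul_coe (q : ℍ) (c : ℂ) : complexPart (q * (c : ℍ)) = c * complexPart q := by
  apply Complex.ext <;> simp [complexPart_re, complexPart_im] <;> ring

theorem complexPart_coe (r : ℝ) : complexPart (r : ℍ) = (r : ℂ) := by
  apply Complex.ext <;> simp [complexPart_re, complexPart_im]

/-- A quaternion is determined by the complex parts of its right multiples. -/
theorem eq_zero_of_complexPart_mul {q : ℍ} (h : ∀ α : ℍ, complexPart (q * α) = 0) : q = 0 := by
  have := h (star q)
  rw [Quaternion.self_mul_star, complexPart_coe] at this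
  exact Quaternion.normSq_eq_zero.mp (by exact_mod_cast this)

/-- The embedding of `ℂ` into `ℍᵐᵒᵖ`; it is multiplicative because `ℂ` is commutative. -/
noncomputable def complexToOpposite : ℂ →+* ℍᵐᵒᵖ :=
  (Quaternion.ofComplex : ℂ →ₐ[ℝ] ℍ).toRingHom.toOpposite fun x y => by
    change (Quaternion.ofComplex x) * (Quaternion.ofComplex y) = _ * _
    rw [← map_mul, mul_comm, map_mul]; rfl

variable {H : Type*} [NormedAddCommGroup H] [RightQuaternionicInnerProductSpace H]

theorem norm_op_smul (α : ℍ) (x : H) : ‖op α • x‖ = ‖α‖ * ‖x‖ := by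
  have h := inner_self (op α • x)
  rw [RightQuaternionicInnerProductSpace.inner_smul_left, QuaternionicOp.inner_smul_right,
    inner_self, mul_assoc, Quaternion.coe_commutes, ← mul_assoc, Quaternion.star_mul_self,
    ← Quaternion.coe_mul] at h
  have h' := Quaternion.coe_injective h
  rw [Quaternion.normSq_eq_norm_mul_self] at h'
  refine (sq_eq_sq₀ (norm_nonneg _) (by positivity)).mp ?_
  rw [← h']; ring

theorem norm_coeComplex (c : ℂ) : ‖(c : ℍ)‖ = ‖c‖ := by
  refine (sq_eq_sq₀ (norm_nonneg _) (norm_nonneg _)).mp ?_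
  rw [sq, ← Quaternion.normSq_eq_norm_mul_self, Quaternion.normSq_def', Complex.sq_norm,
    Complex.normSq_apply]
  simp [sq]

/-- Restricting the scalars from `ℍ` to `ℂ` makes `H` a complex inner product space with the same
norm, in which `⟪x, y⟫` is the complex part of `⟨y, x⟩`; the order is reversed because Mathlib's
inner products are linear in the second variable. -/
noncomputable instance : InnerProductSpace ℂ H where
  toModule := Module.compHom H complexToOpposite
  norm_smul_le c x := by
    change ‖op (c : ℍ) • x‖ ≤ _
    rw [norm_op_smul, norm_coeComplex]
  inner x y := complexPart (inner ℍ y x)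
  norm_sq_eq_re_inner x := by
    rw [inner_self, complexPart_coe]; rfl
  conj_inner_symm x y := by
    rw [← star_inner y x, complexPart_star]; rfl
  add_left x y z := by rw [inner_add_right, map_add]
  smul_left x y c := by
    change complexPart (inner ℍ y (op (c : ℍ) • x)) = _
    rw [← star_inner, RightQuaternionicInnerProductSpace.inner_smul_left, complexPart_star,
      complexPart_mul_coe, ← star_inner x y, complexPart_star]
    simp

theorem complex_inner_def (x y : H) : inner ℂ x y = complexPart (inner ℍ y x) := rfl

/-- Because `D(T)` is invariant under right multiplication by quaternions, the adjoint relation can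
be tested with the complex inner product. -/
theorem mem_adjointGraph_iff {T : H →ₗ.[ℍᵐᵒᵖ] H} {v t : H} :
    (v, t) ∈ adjointGraph T ↔ ∀ x y, (x, y) ∈ T.graph → inner ℂ v y = inner ℂ t x := by
  constructor
  · intro h x y hxy
    obtain ⟨x', rfl, rfl⟩ := T.mem_graph_iff.mp hxy
    have : inner ℍ (T x') v = inner ℍ (x' : H) t := h x'
    rw [complex_inner_def, complex_inner_def, this]
  · intro h x
    change inner ℍ (T x) v = inner ℍ (x : H) t
    rw [← sub_eq_zero]
    refine eq_zero_of_complexPart_mul fun α => ?_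
    have := h _ _ (T.graph.smul_mem (op α) (T.mem_graph x))
    simp only [complex_inner_def, RightQuaternionicInnerProductSpace.inner_smul_left] at this
    rw [sub_mul, map_sub, sub_eq_zero]
    exact this

/-- The adjoint relation is closed, whether or not it is the graph of an operator. -/
theorem isClosed_adjointGraph (T : H →ₗ.[ℍᵐᵒᵖ] H) : IsClosed (adjointGraph T : Set (H × H)) := by
  have : (adjointGraph T : Set (H × H)) =
      ⋂ p ∈ (T.graph : Set (H × H)), {q | inner ℂ q.1 p.2 = inner ℂ q.2 p.1} := by
    ext ⟨v, t⟩
    simp only [SetLike.mem_coe, mem_adjointGraph_iff, Set.mem_iInter, Prod.forall]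
    rfl
  rw [this]
  exact isClosed_biInter fun p _ => isClosed_eq (by fun_prop) (by fun_prop)

/-! ### Everywhere defined bounded operators -/

/-- A bounded right linear operator, viewed as an everywhere defined partial operator. -/
noncomputable def toOp (A : H →L[ℍᵐᵒᵖ] H) : H →ₗ.[ℍᵐᵒᵖ] H :=
  (A : H →ₗ[ℍᵐᵒᵖ] H).toPMap ⊤

/-- A bounded right linear operator, viewed as an operator on the complex Hilbert space `H`. -/
noncomputable def toComplex (A : H →L[ℍᵐᵒᵖ] H) : H →L[ℂ] H where
  toFun := A
  map_add' := map_add A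
  map_smul' c x := map_smul A (op (c : ℍ)) x
  cont := A.continuous

@[simp]
theorem toComplex_apply (A : H →L[ℍᵐᵒᵖ] H) (x : H) : toComplex A x = A x := rfl

theorem toComplex_mul (A B : H →L[ℍᵐᵒᵖ] H) : toComplex (A * B) = toComplex A * toComplex B := rfl

theorem toComplex_injective : Function.Injective (toComplex (H := H)) := fun _ _ h =>
  ContinuousLinearMap.ext fun x => congr($h x)

theorem mem_graph_toOp {A : H →L[ℍᵐᵒᵖ] H} {x y : H} : (x, y) ∈ (toOp A).graph ↔ y = A x := by
  rw [LinearPMap.mem_graph_iff]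
  constructor
  · rintro ⟨x', rfl, rfl⟩; rfl
  · rintro rfl; exact ⟨⟨x, trivial⟩, rfl, rfl⟩

theorem toOp_injective : Function.Injective (toOp (H := H)) := fun A B h =>
  ContinuousLinearMap.ext fun x => by
    rw [← mem_graph_toOp, ← h, mem_graph_toOp]

theorem linearPMap_ext_graph {S T : H →ₗ.[ℍᵐᵒᵖ] H}
    (h : ∀ x y, (x, y) ∈ S.graph ↔ (x, y) ∈ T.graph) : S = T :=
  LinearPMap.eq_of_eq_graph (Submodule.ext fun p => h p.1 p.2)

theorem mem_graph_mulOp {S T : H →ₗ.[ℍᵐᵒᵖ] H} {x z : H} :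
    (x, z) ∈ (mulOp S T).graph ↔ ∃ y, (x, y) ∈ T.graph ∧ (y, z) ∈ S.graph := by
  constructor
  · intro h
    obtain ⟨x', rfl, rfl⟩ := (mulOp S T).mem_graph_iff.mp h
    exact ⟨_, T.mem_graph ⟨x', x'.2.choose⟩, S.mem_graph ⟨_, x'.2.choose_spec⟩⟩
  · rintro ⟨y, hxy, hyz⟩
    obtain ⟨x', rfl, rfl⟩ := T.mem_graph_iff.mp hxy
    obtain ⟨y', hy', rfl⟩ := S.mem_graph_iff.mp hyz
    have hx : (x' : H) ∈ (mulOp S T).domain :=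
      ⟨x'.2, by rw [← show (y' : H) = T x' from hy']; exact y'.2⟩
    refine (mulOp S T).mem_graph_iff.mpr ⟨⟨x', hx⟩, rfl, ?_⟩
    change S ⟨T ⟨x', _⟩, _⟩ = _
    congr 1
    exact Subtype.ext hy'.symm

theorem mem_graph_add {S T : H →ₗ.[ℍᵐᵒᵖ] H} {x z : H} :
    (x, z) ∈ (S + T).graph ↔ ∃ a b, (x, a) ∈ S.graph ∧ (x, b) ∈ T.graph ∧ z = a + b := by
  constructor
  · intro h
    obtain ⟨x', rfl, rfl⟩ := (S + T).mem_graph_iff.mp h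
    exact ⟨_, _, S.mem_graph ⟨x', x'.2.1⟩, T.mem_graph ⟨x', x'.2.2⟩, LinearPMap.add_apply _ _ _⟩
  · rintro ⟨a, b, ha, hb, rfl⟩
    obtain ⟨x', rfl, rfl⟩ := S.mem_graph_iff.mp ha
    obtain ⟨y', hy', rfl⟩ := T.mem_graph_iff.mp hb
    refine (S + T).mem_graph_iff.mpr 
      ⟨⟨x', x'.2, by rw [← show (y' : H) = x' from hy']; exact y'.2⟩, rfl, ?_⟩
    rw [LinearPMap.add_apply]
    congr 2
    exact Subtype.ext hy'.symm

theorem idOp_eq : idOp = toOp (1 : H →L[ℍᵐᵒᵖ] H) := rfl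

theorem toOp_sub (A B : H →L[ℍᵐᵒᵖ] H) : toOp A - toOp B = toOp (A - B) := by
  refine LinearPMap.ext (by rw [LinearPMap.sub_domain]; exact inf_top_eq _) ?_
  rintro x hx hx'
  rw [LinearPMap.sub_apply]
  rfl

theorem mulOp_toOp (A B : H →L[ℍᵐᵒᵖ] H) : mulOp (toOp A) (toOp B) = toOp (A * B) :=
  linearPMap_ext_graph fun x y => by
    simp only [mem_graph_mulOp, mem_graph_toOp, exists_eq_left]; rfl

theorem isClosedOp_toOp (A : H →L[ℍᵐᵒᵖ] H) : IsClosedOp (toOp A) := by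
  have : ((toOp A).graph : Set (H × H)) = {p | p.2 = A p.1} := by
    ext ⟨x, y⟩; exact mem_graph_toOp
  rw [IsClosedOp, this]
  exact isClosed_eq (by fun_prop) (by fun_prop)

/-- An operator with a bound `‖y‖ ≤ M ‖x‖` on its graph and full domain comes from a bounded right
linear map. -/
theorem exists_eq_toOp_of_bound {L : H →ₗ.[ℍᵐᵒᵖ] H} (hdom : ∀ x, ∃ y, (x, y) ∈ L.graph) (M : ℝ)
    (hM : ∀ x y, (x, y) ∈ L.graph → ‖y‖ ≤ M * ‖x‖) : ∃ A, L = toOp A := by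
  choose f hf using hdom
  have uniq : ∀ x y, (x, y) ∈ L.graph → y = f x := fun x y h => L.mem_graph_snd_inj h (hf x) rfl
  let g : H →ₗ[ℍᵐᵒᵖ] H :=
    { toFun := f
      map_add' := fun x y => (uniq _ _ (L.graph.add_mem (hf x) (hf y))).symm
      map_smul' := fun c x => (uniq _ _ (L.graph.smul_mem c (hf x))).symm }
  have hg : Continuous g :=
    AddMonoidHomClass.continuous_of_bound g M fun x => hM _ _ (hf x)
  refine ⟨⟨g, hg⟩, linearPMap_ext_graph fun x y => ⟨fun h => mem_graph_toOp.mpr (uniq x y h), ?_⟩⟩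
  intro h
  rw [mem_graph_toOp.mp h]
  exact hf x

theorem isBoundedOp_toOp (A : H →L[ℍᵐᵒᵖ] H) : IsBoundedOp (toOp A) := by
  refine ⟨rfl, ‖toComplex A‖, ?_⟩
  rintro _ ⟨x, hx, rfl⟩
  exact ((toComplex A).le_opNorm x).trans (mul_le_of_le_one_right (norm_nonneg _) hx)

theorem isBoundedOp_iff {L : H →ₗ.[ℍᵐᵒᵖ] H} : IsBoundedOp L ↔ ∃ A, L = toOp A := by
  refine ⟨fun ⟨hd, M, hM⟩ => ?_, by rintro ⟨A, rfl⟩; exact isBoundedOp_toOp A⟩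
  refine exists_eq_toOp_of_bound
    (fun x => LinearPMap.mem_domain_iff.mp (hd ▸ Submodule.mem_top)) M fun x y hxy => ?_
  rcases eq_or_ne x 0 with rfl | hx
  · simp [L.graph_fst_eq_zero_snd hxy rfl]
  -- rescale `x` to the unit sphere
  obtain ⟨u, hu, hu'⟩ := L.mem_graph_iff.mp (L.graph.smul_mem (op ((‖x‖⁻¹ : ℝ) : ℍ)) hxy)
  have hx' : 0 < ‖x‖ := norm_pos_iff.mpr hx
  have h : ‖L u‖ ≤ M := hM ⟨u, by
    rw [hu, Prod.smul_fst, norm_op_smul, Quaternion.norm_coe, norm_inv, norm_norm,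
      inv_mul_cancel₀ hx'.ne'], rfl⟩
  rw [hu'] at h
  simp only [Prod.smul_snd, norm_op_smul, Quaternion.norm_coe, norm_inv, norm_norm] at h
  rwa [inv_mul_le_iff₀ hx', mul_comm] at h

variable [CompleteSpace H]

theorem mem_adjointGraph_toOp {A : H →L[ℍᵐᵒᵖ] H} {v t : H} :
    (v, t) ∈ adjointGraph (toOp A) ↔ t = (toComplex A).adjoint v := by
  simp only [mem_adjointGraph_iff, mem_graph_toOp, forall_eq]
  constructor
  · intro h
    refine ext_inner_right ℂ fun x => ?_
    rw [← h, ContinuousLinearMap.adjoint_inner_left, toComplex_apply]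
  · rintro rfl x
    rw [ContinuousLinearMap.adjoint_inner_left, toComplex_apply]

theorem mem_graph_adjointOp_toOp {A : H →L[ℍᵐᵒᵖ] H} {v t : H} :
    (v, t) ∈ (adjointOp (toOp A)).graph ↔ t = (toComplex A).adjoint v := by
  rw [graph_adjointOp _ dense_univ, mem_adjointGraph_toOp]

/-- Quaternionic and complex positivity agree for right linear operators: a complex positive one is
symmetric for the quaternionic inner product as well, so that `⟨A x, x⟩` is real. -/
theorem isPositiveOp_toOp_iff {A : H →L[ℍᵐᵒᵖ] H} : IsPositiveOp (toOp A) ↔ 0 ≤ toComplex A := by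
  rw [ContinuousLinearMap.nonneg_iff_isPositive, ContinuousLinearMap.isPositive_iff_complex]
  constructor
  · intro h x
    obtain ⟨r, hr, h⟩ := h ⟨x, trivial⟩
    have h' : inner ℂ (A x) x = (r : ℂ) := by
      rw [complex_inner_def, ← star_inner]
      change complexPart (star (inner ℍ (toOp A ⟨x, trivial⟩) x)) = r
      rw [h, Quaternion.star_coe, complexPart_coe]
    simp [h', hr]
  · intro h x
    have hs : (toComplex A).adjoint = toComplex A :=
      ((ContinuousLinearMap.isPositive_iff_complex _).mpr h).isSelfAdjoint
    have hx : ((x : H), A x) ∈ adjointGraph (toOp A) := mem_adjointGraph_toOp.mpr (by rw [hs]; rfl)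
    have hx' : inner ℍ (A x) (x : H) = inner ℍ (x : H) (A x) := hx x
    have hreal := Quaternion.star_eq_self.mp (show star _ = inner ℍ (A x) (x : H) by
      rw [star_inner, ← hx'])
    refine ⟨_, ?_, hreal⟩
    have := (h x).2
    rw [toComplex_apply, complex_inner_def, ← hx'] at this
    simpa [complexPart_re] using this

end QuaternionicOp

/-! ### Square roots and intertwining relations -/

open Polynomial in
/-- On `[0, 1]` the square root is a uniform limit of polynomials, so one polynomial serves all
positive contractions at once. -/
theorem CFC.exists_polynomial_norm_sqrt_sub_aeval_le {A : Type*} [CStarAlgebra A] [PartialOrder A]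
    [StarOrderedRing A] {ε : ℝ} (hε : 0 < ε) :
    ∃ p : ℝ[X], ∀ a : A, 0 ≤ a → ‖a‖ ≤ 1 → ‖CFC.sqrt a - aeval a p‖ ≤ ε := by
  obtain ⟨p, hp⟩ := exists_polynomial_near_of_continuousOn 0 1 Real.sqrt
    Real.continuous_sqrt.continuousOn ε hε
  refine ⟨p, fun a ha ha1 => ?_⟩
  rcases subsingleton_or_nontrivial A with _ | _
  · rw [Subsingleton.elim (CFC.sqrt a - aeval a p) 0, norm_zero]
    exact hε.le
  rw [CFC.sqrt_eq_real_sqrt a, cfcₙ_eq_cfc, ← cfc_polynomial p a, ← cfc_sub ..]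
  refine norm_cfc_le hε.le fun x hx => ?_
  rw [norm_sub_rev]
  refine (hp x ⟨spectrum_nonneg_of_nonneg ha hx, ?_⟩).le
  exact (le_abs_self x).trans ((spectrum.norm_le_norm_of_mem hx).trans ha1)

open Polynomial in
theorem ContinuousLinearMap.map_aeval_of_intertwines {E : Type*} [NormedAddCommGroup E]
    [NormedSpace ℂ E] (D : E →L[ℝ] E) {a b : E →L[ℂ] E} (h : ∀ x, D (a x) = b (D x))
    (p : ℝ[X]) (x : E) : D (aeval a p x) = aeval b p (D x) := by
  induction p using Polynomial.induction_on generalizing x with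
  | C r =>
    simp only [aeval_C, Algebra.algebraMap_eq_smul_one, smul_apply,
      one_apply_eq_self, map_smul]
  | add p q hp hq => simp only [map_add, add_apply, hp, hq]
  | monomial n r ih =>
    simp only [pow_succ, ← mul_assoc, map_mul _ (_ * _) X, aeval_X,
      mul_apply_eq_comp] at ih ⊢
    rw [ih, h]

/-- Square roots inherit intertwining relations. The intertwining map `D` is only required to be
real linear, which allows right multiplications by quaternions. -/
theorem ContinuousLinearMap.map_sqrt_of_intertwines {E : Type*} [NormedAddCommGroup E]
    [InnerProductSpace ℂ E] [CompleteSpace E] (D : E →L[ℝ] E) {a b : E →L[ℂ] E}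
    (ha : 0 ≤ a) (ha1 : ‖a‖ ≤ 1) (hb : 0 ≤ b) (hb1 : ‖b‖ ≤ 1)
    (h : ∀ x, D (a x) = b (D x)) (x : E) : D (CFC.sqrt a x) = CFC.sqrt b (D x) := by
  rw [← sub_eq_zero, ← norm_le_zero_iff]
  have key : ∀ ε > 0, ‖D (CFC.sqrt a x) - CFC.sqrt b (D x)‖ ≤ ε * (‖D‖ * ‖x‖ + ‖D x‖) := by
    intro ε hε
    obtain ⟨p, hp⟩ := CFC.exists_polynomial_norm_sqrt_sub_aeval_le (A := E →L[ℂ] E) hε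
    have e : D (CFC.sqrt a x) - CFC.sqrt b (D x) =
        D ((CFC.sqrt a - Polynomial.aeval a p) x) - (CFC.sqrt b - Polynomial.aeval b p) (D x) := by
      simp only [sub_apply, map_sub, D.map_aeval_of_intertwines h]
      abel
    rw [e]
    refine (norm_sub_le _ _).trans ?_
    have h1 := D.le_opNorm_of_le
      ((CFC.sqrt a - Polynomial.aeval a p).le_of_opNorm_le (hp a ha ha1) x)
    have h2 := (CFC.sqrt b - Polynomial.aeval b p).le_of_opNorm_le (hp b hb hb1) (D x)
    linarith
  set M := ‖D‖ * ‖x‖ + ‖D x‖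
  have hM : 0 ≤ M := by positivity
  refine le_of_forall_pos_le_add fun δ hδ => ?_
  refine (key (δ / (M + 1)) (by positivity)).trans ?_
  rw [zero_add, div_mul_eq_mul_div, div_le_iff₀ (by positivity)]
  nlinarith

namespace QuaternionicOp

variable {H : Type*} [NormedAddCommGroup H] [RightQuaternionicInnerProductSpace H]

/-- Right multiplication by a quaternion, as a real linear map. -/
noncomputable def rightMul (α : ℍ) : H →L[ℝ] H :=
  AddMonoidHom.toRealLinearMap (DistribSMul.toAddMonoidHom H (MulOpposite.op α))
    (AddMonoidHomClass.continuous_of_bound _ ‖α‖ fun x => (norm_op_smul α x).le)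

variable [CompleteSpace H]

/-- The complex square root of a positive right linear contraction is again right linear. -/
theorem exists_toComplex_eq_sqrt {C : H →L[ℍᵐᵒᵖ] H} (hC : 0 ≤ toComplex C)
    (hC1 : ‖toComplex C‖ ≤ 1) :
    ∃ W : H →L[ℍᵐᵒᵖ] H, toComplex W = CFC.sqrt (toComplex C) :=
  ⟨{ toFun := (CFC.sqrt (toComplex C) : H →L[ℂ] H)
     map_add' := map_add _
     map_smul' := fun c x =>
      ((rightMul c.unop).map_sqrt_of_intertwines hC hC1 hC hC1
        (fun y => (map_smul C c y).symm) x).symm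
     cont := ContinuousLinearMap.continuous _ }, rfl⟩

theorem isPositiveSqrt_toOp_iff {C W : H →L[ℍᵐᵒᵖ] H} :
    IsPositiveSqrt (toOp C) (toOp W) ↔ 0 ≤ toComplex W ∧ W * W = C := by
  simp only [IsPositiveSqrt, isBoundedOp_toOp, isPositiveOp_toOp_iff, mulOp_toOp,
    toOp_injective.eq_iff, true_and]

theorem eq_toOp_of_isPositiveSqrt {C W : H →L[ℍᵐᵒᵖ] H}
    (hW : toComplex W = CFC.sqrt (toComplex C)) {V : H →ₗ.[ℍᵐᵒᵖ] H}
    (hV : IsPositiveSqrt (toOp C) V) : V = toOp W := by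
  obtain ⟨V, rfl⟩ := isBoundedOp_iff.mp hV.1
  obtain ⟨hV0, hVV⟩ := isPositiveSqrt_toOp_iff.mp hV
  congr 1
  refine toComplex_injective ?_
  rw [hW]
  exact (CFC.sqrt_unique (by rw [← toComplex_mul, hVV]) hV0).symm

theorem isPositiveSqrt_of_toComplex_eq_sqrt {C W : H →L[ℍᵐᵒᵖ] H} (hC : 0 ≤ toComplex C)
    (hW : toComplex W = CFC.sqrt (toComplex C)) : IsPositiveSqrt (toOp C) (toOp W) := by
  refine isPositiveSqrt_toOp_iff.mpr ⟨hW ▸ CFC.sqrt_nonneg _, toComplex_injective ?_⟩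
  rw [toComplex_mul, hW, CFC.sqrt_mul_sqrt_self _ hC]

theorem sqrtOp_toOp {C W : H →L[ℍᵐᵒᵖ] H} (hC : 0 ≤ toComplex C)
    (hW : toComplex W = CFC.sqrt (toComplex C)) : sqrtOp (toOp C) = toOp W :=
  eq_toOp_of_isPositiveSqrt hW
    (Classical.epsilon_spec ⟨_, isPositiveSqrt_of_toComplex_eq_sqrt hC hW⟩)

end QuaternionicOp

/-! ### The graph decomposition and its consequences -/

namespace QuaternionicOp

open ContinuousLinearMap (adjoint_inner_left adjoint_inner_right)

variable {H : Type*} [NormedAddCommGroup H] [RightQuaternionicInnerProductSpace H]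

/-- The graph of an operator as a subspace of the complex Hilbert space `H ⊕ H`. -/
noncomputable def complexGraph (T : H →ₗ.[ℍᵐᵒᵖ] H) : Submodule ℂ (WithLp 2 (H × H)) where
  carrier := {p | (p.fst, p.snd) ∈ T.graph}
  zero_mem' := T.graph.zero_mem
  add_mem' hp hq := T.graph.add_mem hp hq
  smul_mem' c _ hp := T.graph.smul_mem (MulOpposite.op (c : ℍ)) hp

variable {T : H →ₗ.[ℍᵐᵒᵖ] H}

theorem isClosedOp_adjointOp (hdense : Dense (T.domain : Set H)) : IsClosedOp (adjointOp T) := by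
  rw [IsClosedOp, graph_adjointOp T hdense]
  exact isClosed_adjointGraph T

section

variable [CompleteSpace H]

/-- The orthogonal complement in `H ⊕ H` of the closed graph of `T` is `{(t, -v) | T* v = t}`. -/
theorem exists_graph_decomposition (hclosed : IsClosedOp T) (a b : H) :
    ∃ x y v t, (x, y) ∈ T.graph ∧ (v, t) ∈ adjointGraph T ∧ a = x + t ∧ b = y - v := by
  have hK : IsClosed (complexGraph T : Set (WithLp 2 (H × H))) :=
    IsClosed.preimage (f := fun p : WithLp 2 (H × H) => (p.fst, p.snd)) (by fun_prop) hclosed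
  have : CompleteSpace (complexGraph T) := hK.completeSpace_coe
  obtain ⟨p, hp, q, hq, h⟩ :=
    (complexGraph T).exists_add_mem_mem_orthogonal (WithLp.toLp 2 (a, b))
  refine ⟨p.fst, p.snd, -q.snd, q.fst, hp, mem_adjointGraph_iff.mpr fun x y hxy => ?_,
    congr(($h).fst), ?_⟩
  · have := Submodule.inner_left_of_mem_orthogonal (u := WithLp.toLp 2 (x, y)) hxy hq
    rw [WithLp.prod_inner_apply] at this
    rw [inner_neg_left]
    exact neg_eq_of_add_eq_zero_left this
  · rw [sub_neg_eq_add]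
    exact congr(($h).snd)

theorem dense_domain_adjointOp (hdense : Dense (T.domain : Set H)) (hclosed : IsClosedOp T) :
    Dense ((adjointOp T).domain : Set H) := by
  let K : Submodule ℂ H :=
    { carrier := (adjointOp T).domain
      zero_mem' := (adjointOp T).domain.zero_mem
      add_mem' := (adjointOp T).domain.add_mem
      smul_mem' := fun c _ hx => (adjointOp T).domain.smul_mem (MulOpposite.op (c : ℍ)) hx }
  change Dense (K : Set H)
  rw [Submodule.dense_iff_topologicalClosure_eq_top, Submodule.topologicalClosure_eq_top_iff,
    Submodule.eq_bot_iff]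
  intro b hb
  obtain ⟨x, y, v, t, hxy, hvt, h0, rfl⟩ := exists_graph_decomposition hclosed 0 b
  have hv : v ∈ (adjointOp T).domain :=
    LinearPMap.mem_domain_iff.mpr ⟨t, by rwa [graph_adjointOp T hdense]⟩
  have h1 : inner ℂ v (y - v) = 0 := Submodule.inner_right_of_mem_orthogonal (K := K) hv hb
  rw [inner_sub_right, mem_adjointGraph_iff.mp hvt _ _ hxy, eq_neg_of_add_eq_zero_left h0.symm,
    inner_neg_right, inner_self_eq_norm_sq_to_K, inner_self_eq_norm_sq_to_K] at h1
  have h2 : -‖t‖ ^ 2 - ‖v‖ ^ 2 = 0 := by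
    rw [← Complex.ofReal_inj]
    push_cast
    exact h1
  have ht : t = 0 := norm_eq_zero.mp (by nlinarith [norm_nonneg t, norm_nonneg v])
  have hv' : v = 0 := norm_eq_zero.mp (by nlinarith [norm_nonneg t, norm_nonneg v])
  subst ht hv'
  rw [add_zero] at h0
  rw [sub_zero]
  exact T.graph_fst_eq_zero_snd hxy h0.symm

theorem adjointOp_adjointOp (hdense : Dense (T.domain : Set H)) (hclosed : IsClosedOp T) :
    adjointOp (adjointOp T) = T := by
  have hle : T.graph ≤ (adjointOp (adjointOp T)).graph := by
    rw [graph_adjointOp _ (dense_domain_adjointOp hdense hclosed)]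
    rintro ⟨x, y⟩ hxy
    refine mem_adjointGraph_iff.mpr fun v t hvt => ?_
    rw [graph_adjointOp T hdense] at hvt
    rw [← inner_conj_symm, ← inner_conj_symm y, mem_adjointGraph_iff.mp hvt x y hxy]
  refine LinearPMap.eq_of_eq_graph (le_antisymm ?_ hle)
  rintro ⟨a, b⟩ hab
  obtain ⟨x, y, v, t, hxy, hvt, rfl, rfl⟩ := exists_graph_decomposition hclosed a b
  -- the component of `(a, b)` orthogonal to the graph of `T` lies in the graph of `T**`
  have hd := (adjointOp (adjointOp T)).graph.sub_mem hab (hle hxy)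
  rw [graph_adjointOp _ (dense_domain_adjointOp hdense hclosed)] at hd
  have h1 := mem_adjointGraph_iff.mp hd v t (by rwa [graph_adjointOp T hdense])
  rw [add_sub_cancel_left, sub_sub_cancel_left, inner_neg_left, inner_self_eq_norm_sq_to_K,
    inner_self_eq_norm_sq_to_K] at h1
  have h2 : ‖t‖ ^ 2 = -‖v‖ ^ 2 := by exact_mod_cast h1
  have ht : t = 0 := norm_eq_zero.mp (by nlinarith [norm_nonneg t, norm_nonneg v])
  have hv : v = 0 := norm_eq_zero.mp (by nlinarith [norm_nonneg t, norm_nonneg v])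
  subst ht hv
  rwa [add_zero, sub_zero]

end

/-! ### The operator `C_T` -/

theorem mem_graph_oneAddAdjointMul (hdense : Dense (T.domain : Set H)) {x h : H} :
    (x, h) ∈ (oneAddAdjointMul T).graph ↔
      ∃ y t, (x, y) ∈ T.graph ∧ (y, t) ∈ adjointGraph T ∧ h = x + t := by
  simp only [oneAddAdjointMul, mem_graph_add, idOp_eq, mem_graph_toOp, mem_graph_mulOp,
    graph_adjointOp T hdense]
  constructor
  · rintro ⟨_, t, rfl, ⟨y, hxy, hyt⟩, rfl⟩; exact ⟨y, t, hxy, hyt, rfl⟩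
  · rintro ⟨y, t, hxy, hyt, rfl⟩; exact ⟨_, t, rfl, ⟨y, hxy, hyt⟩, rfl⟩

/-- The form `⟨(I + T* T) x, x⟩ = ‖x‖² + ‖T x‖²`. -/
theorem inner_add_of_mem_graph {x y t : H} (hxy : (x, y) ∈ T.graph)
    (hyt : (y, t) ∈ adjointGraph T) :
    inner ℂ (x + t) x = ((‖x‖ ^ 2 + ‖y‖ ^ 2 : ℝ) : ℂ) := by
  rw [inner_add_left, ← mem_adjointGraph_iff.mp hyt _ _ hxy, inner_self_eq_norm_sq_to_K,
    inner_self_eq_norm_sq_to_K]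
  push_cast
  rfl

theorem norm_le_of_mem_graph_oneAddAdjointMul (hdense : Dense (T.domain : Set H)) {x h : H}
    (hx : (x, h) ∈ (oneAddAdjointMul T).graph) : ‖x‖ ≤ ‖h‖ := by
  obtain ⟨y, t, hxy, hyt, rfl⟩ := (mem_graph_oneAddAdjointMul hdense).mp hx
  have h1 := norm_inner_le_norm (𝕜 := ℂ) (x + t) x
  rw [inner_add_of_mem_graph hxy hyt, Complex.norm_real, Real.norm_of_nonneg (by positivity)] at h1
  by_contra! hlt
  nlinarith [norm_nonneg (x + t), sq_nonneg ‖y‖]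

theorem ker_oneAddAdjointMul (hdense : Dense (T.domain : Set H)) :
    LinearMap.ker (oneAddAdjointMul T).toFun = ⊥ := by
  refine LinearMap.ker_eq_bot'.mpr fun x hx => ?_
  have hg := (oneAddAdjointMul T).mem_graph x
  rw [show (oneAddAdjointMul T) x = 0 from hx] at hg
  have := norm_le_of_mem_graph_oneAddAdjointMul hdense hg
  rw [norm_zero, norm_le_zero_iff] at this
  exact Subtype.ext this

theorem mem_graph_cOp (hdense : Dense (T.domain : Set H)) {x h : H} :
    (h, x) ∈ (cOp T).graph ↔ (x, h) ∈ (oneAddAdjointMul T).graph := by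
  rw [cOp, LinearPMap.inverse_graph (ker_oneAddAdjointMul hdense)]
  constructor
  · rintro ⟨⟨x', h'⟩, hp, he⟩
    obtain ⟨rfl, rfl⟩ := Prod.ext_iff.mp he
    exact hp
  · exact fun hx => ⟨_, hx, rfl⟩

/-- For `x = C h` the equation `x + T* T x = h` holds. -/
theorem exists_of_cOp_eq (hdense : Dense (T.domain : Set H)) {C : H →L[ℍᵐᵒᵖ] H}
    (hC : cOp T = toOp C) (h : H) :
    ∃ y t, (C h, y) ∈ T.graph ∧ (y, t) ∈ adjointGraph T ∧ h = C h + t :=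
  (mem_graph_oneAddAdjointMul hdense).mp
    ((mem_graph_cOp hdense).mp (hC ▸ mem_graph_toOp.mpr rfl))

theorem eq_of_cOp_eq (hdense : Dense (T.domain : Set H)) {C : H →L[ℍᵐᵒᵖ] H}
    (hC : cOp T = toOp C) {x y t : H} (hxy : (x, y) ∈ T.graph) (hyt : (y, t) ∈ adjointGraph T) :
    C (x + t) = x := by
  refine (mem_graph_toOp.mp ?_).symm
  rw [← hC, mem_graph_cOp hdense, mem_graph_oneAddAdjointMul hdense]
  exact ⟨y, t, hxy, hyt, rfl⟩

variable [CompleteSpace H]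

/-- `C_T` is everywhere defined because `(h, 0) = (x, T x) + (T* v, -v)` forces `v = T x` and
`h = x + T* T x`; it is a contraction because `‖x‖² ≤ ⟨(I + T* T) x, x⟩`. -/
theorem exists_cOp_eq_toOp (hdense : Dense (T.domain : Set H)) (hclosed : IsClosedOp T) :
    ∃ C : H →L[ℍᵐᵒᵖ] H, cOp T = toOp C ∧ 0 ≤ toComplex C ∧ ‖toComplex C‖ ≤ 1 := by
  obtain ⟨C, hC⟩ : ∃ C, cOp T = toOp C := by
    refine exists_eq_toOp_of_bound (fun h => ?_) 1 fun h x hx => ?_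
    · obtain ⟨x, y, v, t, hxy, hvt, rfl, h0⟩ := exists_graph_decomposition hclosed h 0
      obtain rfl := sub_eq_zero.mp h0.symm
      exact ⟨x, (mem_graph_cOp hdense).mpr
        ((mem_graph_oneAddAdjointMul hdense).mpr ⟨y, t, hxy, hvt, rfl⟩)⟩
    · rw [one_mul]
      exact norm_le_of_mem_graph_oneAddAdjointMul hdense ((mem_graph_cOp hdense).mp hx)
  have hg : ∀ h, (C h, h) ∈ (oneAddAdjointMul T).graph := fun h =>
    (mem_graph_cOp hdense).mp (hC ▸ mem_graph_toOp.mpr rfl)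
  refine ⟨C, hC, ?_, ContinuousLinearMap.opNorm_le_bound _ zero_le_one fun h => ?_⟩
  · rw [ContinuousLinearMap.nonneg_iff_isPositive, ContinuousLinearMap.isPositive_iff_complex]
    intro h
    obtain ⟨y, t, hxy, hyt, he⟩ := (mem_graph_oneAddAdjointMul hdense).mp (hg h)
    have h1 := inner_add_of_mem_graph hxy hyt
    rw [← he] at h1
    rw [toComplex_apply, ← inner_conj_symm, h1, Complex.conj_ofReal]
    refine ⟨rfl, ?_⟩
    change (0 : ℝ) ≤ ‖C h‖ ^ 2 + ‖y‖ ^ 2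
    positivity
  · rw [one_mul]
    exact norm_le_of_mem_graph_oneAddAdjointMul hdense (hg h)

/-! ### The bounded transform -/

/-- The bounded right linear maps `C`, `W`, `Z` represent `C_T`, `C_T^{1/2}` and
`Z_T = T C_T^{1/2}`. The square root is taken in the C⋆-algebra of operators on the
complex Hilbert space `H`. -/
structure IsBoundedTransform (T : H →ₗ.[ℍᵐᵒᵖ] H) (C W Z : H →L[ℍᵐᵒᵖ] H) : Prop where
  cOp_eq : cOp T = toOp C
  nonneg : 0 ≤ toComplex C
  norm_le_one : ‖toComplex C‖ ≤ 1
  toComplex_eq_sqrt : toComplex W = CFC.sqrt (toComplex C)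
  mem_graph : ∀ x, (W x, Z x) ∈ T.graph

theorem denseRange_of_mul_self_eq {C W : H →L[ℍᵐᵒᵖ] H} (hdense : Dense (T.domain : Set H))
    (hC : cOp T = toOp C) (hW : (toComplex W).adjoint = toComplex W) (hWW : W * W = C) :
    DenseRange W := by
  change Dense (LinearMap.range (toComplex W).toLinearMap : Set H)
  rw [Submodule.dense_iff_topologicalClosure_eq_top, Submodule.topologicalClosure_eq_top_iff,
    ContinuousLinearMap.orthogonal_range, hW]
  refine LinearMap.ker_eq_bot'.mpr fun x (hx : W x = 0) => ?_
  -- `C x = W (W x) = 0`, while `x = C x + T* T C x`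
  have hCx : C x = 0 := by rw [← hWW, mul_apply_eq_comp, hx, map_zero]
  obtain ⟨y, t, hxy, hyt, he⟩ := exists_of_cOp_eq hdense hC x
  rw [hCx] at hxy he
  obtain rfl := T.graph_fst_eq_zero_snd hxy rfl
  rw [← graph_adjointOp T hdense] at hyt
  rw [he, (adjointOp T).graph_fst_eq_zero_snd hyt rfl, add_zero]

/-- `T W` is defined everywhere. On the dense range of `W`, `‖T W (W x)‖ = ‖T C x‖ ≤ ‖W x‖`,
and the closedness of `T` passes this on to all of `H`. -/
theorem exists_mem_graph_of_mul_self_eq {C W : H →L[ℍᵐᵒᵖ] H} (hdense : Dense (T.domain : Set H))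
    (hclosed : IsClosedOp T) (hC : cOp T = toOp C) (hW : (toComplex W).adjoint = toComplex W)
    (hWW : W * W = C) (z : H) : ∃ y, (W z, y) ∈ T.graph ∧ ‖y‖ ≤ ‖z‖ := by
  have hnorm : ∀ x y, (C x, y) ∈ T.graph → ‖y‖ ≤ ‖W x‖ := by
    intro x y hxy
    obtain ⟨y', t, hxy', hyt, he⟩ := exists_of_cOp_eq hdense hC x
    obtain rfl := T.mem_graph_snd_inj hxy hxy' rfl
    have h1 := inner_add_of_mem_graph hxy hyt
    rw [← he] at h1
    have h2 : inner ℂ x (C x) = ((‖W x‖ ^ 2 : ℝ) : ℂ) := by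
      rw [← hWW, mul_apply_eq_comp, ← toComplex_apply W (W x),
        ← adjoint_inner_left, hW, toComplex_apply, inner_self_eq_norm_sq_to_K]
      push_cast
      rfl
    rw [h2, Complex.ofReal_inj] at h1
    refine le_of_sq_le_sq ?_ (norm_nonneg _)
    nlinarith [sq_nonneg ‖C x‖]
  obtain ⟨u, hu, hlim⟩ := mem_closure_iff_seq_limit.mp
    (denseRange_of_mul_self_eq hdense hC hW hWW z)
  choose x hx using hu
  choose y t hxy hyt he using fun n => exists_of_cOp_eq hdense hC (x n)
  have hcauchy : CauchySeq y := by
    rw [cauchySeq_iff_tendsto_dist_atTop_0]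
    refine squeeze_zero (fun _ => dist_nonneg) (fun n => ?_)
      (cauchySeq_iff_tendsto_dist_atTop_0.mp hlim.cauchySeq)
    rw [dist_eq_norm, dist_eq_norm, ← hx, ← hx, ← map_sub]
    refine hnorm _ _ ?_
    rw [map_sub]
    exact T.graph.sub_mem (hxy _) (hxy _)
  obtain ⟨y₀, hy₀⟩ := cauchySeq_tendsto_of_complete hcauchy
  refine ⟨y₀, ?_, le_of_tendsto_of_tendsto' hy₀.norm hlim.norm fun n => hx n ▸ hnorm _ _ (hxy n)⟩
  refine hclosed.mem_of_tendsto (((W.continuous.tendsto z).comp hlim).prodMk_nhds hy₀)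
    (Filter.Eventually.of_forall fun n => ?_)
  rw [Function.comp_apply, ← hx, ← mul_apply_eq_comp, hWW]
  exact hxy n

theorem exists_isBoundedTransform (hdense : Dense (T.domain : Set H)) (hclosed : IsClosedOp T) :
    ∃ C W Z, IsBoundedTransform T C W Z := by
  obtain ⟨C, hC, hC0, hC1⟩ := exists_cOp_eq_toOp hdense hclosed
  obtain ⟨W, hW⟩ := exists_toComplex_eq_sqrt hC0 hC1
  have hWW := isPositiveSqrt_toOp_iff.mp (isPositiveSqrt_of_toComplex_eq_sqrt hC0 hW)
  have hWs : (toComplex W).adjoint = toComplex W :=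
    ((ContinuousLinearMap.nonneg_iff_isPositive _).mp hWW.1).isSelfAdjoint
  have key := exists_mem_graph_of_mul_self_eq hdense hclosed hC hWs hWW.2
  obtain ⟨Z, hZ⟩ : ∃ Z, mulOp T (toOp W) = toOp Z := by
    refine exists_eq_toOp_of_bound (fun x => ?_) 1 fun x y hxy => ?_
    · obtain ⟨y, hy, -⟩ := key x
      exact ⟨y, mem_graph_mulOp.mpr ⟨_, mem_graph_toOp.mpr rfl, hy⟩⟩
    · obtain ⟨w, hw, hwy⟩ := mem_graph_mulOp.mp hxy
      obtain rfl := mem_graph_toOp.mp hw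
      obtain ⟨y', hy', hle⟩ := key x
      rw [one_mul, T.mem_graph_snd_inj hwy hy' rfl]
      exact hle
  refine ⟨C, W, Z, hC, hC0, hC1, hW, fun x => ?_⟩
  obtain ⟨w, hw, hwy⟩ := mem_graph_mulOp.mp (hZ ▸ mem_graph_toOp.mpr rfl : (x, Z x) ∈ _)
  rwa [← mem_graph_toOp.mp hw]

namespace IsBoundedTransform

variable {C W Z C' W' Z' : H →L[ℍᵐᵒᵖ] H}

theorem zOp_eq (h : IsBoundedTransform T C W Z) : zOp T = toOp Z := by
  rw [zOp, h.cOp_eq, sqrtOp_toOp h.nonneg h.toComplex_eq_sqrt]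
  refine linearPMap_ext_graph fun x y => ?_
  simp only [mem_graph_mulOp, mem_graph_toOp, exists_eq_left]
  exact ⟨fun hy => T.mem_graph_snd_inj hy (h.mem_graph x) rfl, fun hy => hy ▸ h.mem_graph x⟩

theorem isPositiveSqrt (h : IsBoundedTransform T C W Z) : IsPositiveSqrt (toOp C) (toOp W) :=
  isPositiveSqrt_of_toComplex_eq_sqrt h.nonneg h.toComplex_eq_sqrt

theorem sqrt_sqrt (h : IsBoundedTransform T C W Z) (x : H) : W (W x) = C x :=
  congr($((isPositiveSqrt_toOp_iff.mp h.isPositiveSqrt).2) x)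

theorem adjoint_sqrt (h : IsBoundedTransform T C W Z) : (toComplex W).adjoint = toComplex W :=
  ((ContinuousLinearMap.nonneg_iff_isPositive _).mp
    (isPositiveSqrt_toOp_iff.mp h.isPositiveSqrt).1).isSelfAdjoint

theorem inner_sqrt_left (h : IsBoundedTransform T C W Z) (x y : H) :
    inner ℂ (W x) y = inner ℂ x (W y) := by
  rw [← toComplex_apply W y, ← adjoint_inner_left, h.adjoint_sqrt, toComplex_apply]

theorem denseRange_sqrt (h : IsBoundedTransform T C W Z) (hdense : Dense (T.domain : Set H)) :
    DenseRange W :=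
  denseRange_of_mul_self_eq hdense h.cOp_eq h.adjoint_sqrt
    (isPositiveSqrt_toOp_iff.mp h.isPositiveSqrt).2

theorem mem_graph_c (h : IsBoundedTransform T C W Z) (x : H) : (C x, Z (W x)) ∈ T.graph := by
  rw [← h.sqrt_sqrt]
  exact h.mem_graph (W x)

theorem mem_adjointGraph_c (h : IsBoundedTransform T C W Z) (hdense : Dense (T.domain : Set H))
    (x : H) : (Z (W x), x - C x) ∈ adjointGraph T := by
  obtain ⟨y, t, hxy, hyt, he⟩ := exists_of_cOp_eq hdense h.cOp_eq x
  rw [T.mem_graph_snd_inj (h.mem_graph_c x) hxy rfl, sub_eq_of_eq_add' he]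
  exact hyt

/-- `Z_T* Z_T = I - C_T`: on the dense range of `W` this is `⟨T C x, T W z⟩ = ⟨x - C x, W z⟩`. -/
theorem adjoint_apply_apply (h : IsBoundedTransform T C W Z) (hdense : Dense (T.domain : Set H))
    (x : H) : (toComplex Z).adjoint (Z x) = x - C x := by
  refine congr_fun (DenseRange.equalizer (h.denseRange_sqrt hdense)
    (g := fun x => (toComplex Z).adjoint (Z x)) (h := fun x => x - C x)
    (by fun_prop) (by fun_prop) (funext fun a => ?_)) x
  refine ext_inner_right ℂ fun z => ?_
  change inner ℂ ((toComplex Z).adjoint (Z (W a))) z = inner ℂ (W a - C (W a)) z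
  rw [adjoint_inner_left, toComplex_apply,
    mem_adjointGraph_iff.mp (h.mem_adjointGraph_c hdense a) _ _ (h.mem_graph z),
    ← h.inner_sqrt_left, map_sub, ← h.sqrt_sqrt a, ← h.sqrt_sqrt (W a)]

theorem norm_apply_le (h : IsBoundedTransform T C W Z) (hdense : Dense (T.domain : Set H))
    (x : H) : ‖Z x‖ ≤ ‖x‖ := by
  have h1 : inner ℂ (Z x) (Z x) = inner ℂ (x - C x) x := by
    rw [← h.adjoint_apply_apply hdense, adjoint_inner_left, toComplex_apply]
  rw [inner_sub_left, ← h.sqrt_sqrt, h.inner_sqrt_left, inner_self_eq_norm_sq_to_K,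
    inner_self_eq_norm_sq_to_K, inner_self_eq_norm_sq_to_K] at h1
  have h2 : ‖Z x‖ ^ 2 = ‖x‖ ^ 2 - ‖W x‖ ^ 2 := by
    rw [← Complex.ofReal_inj]
    push_cast
    exact h1
  refine le_of_sq_le_sq ?_ (norm_nonneg _)
  nlinarith [sq_nonneg ‖W x‖]

theorem mulOp_adjointOp_zOp (h : IsBoundedTransform T C W Z) (hdense : Dense (T.domain : Set H)) :
    mulOp (adjointOp (zOp T)) (zOp T) = toOp (1 - C) := by
  rw [h.zOp_eq]
  refine linearPMap_ext_graph fun x y => ?_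
  simp only [mem_graph_mulOp, mem_graph_toOp, exists_eq_left, mem_graph_adjointOp_toOp,
    h.adjoint_apply_apply hdense]
  rfl

/-- `C_{T*} Z_T = Z_T C_T`. On the dense range of `W` this reads `C_{T*} T u = T C_T u` with
`u = C_T x`, which follows by applying `T` to `u = C_T u + T* T C_T u`. -/
theorem apply_c (h : IsBoundedTransform T C W Z)
    (h' : IsBoundedTransform (adjointOp T) C' W' Z') (hdense : Dense (T.domain : Set H))
    (hclosed : IsClosedOp T) (x : H) : Z (C x) = C' (Z x) := by
  refine congr_fun (DenseRange.equalizer (h.denseRange_sqrt hdense)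
    (g := fun x => Z (C x)) (h := fun x => C' (Z x))
    (by fun_prop) (by fun_prop) (funext fun a => ?_)) x
  change Z (C (W a)) = C' (Z (W a))
  have h1 := T.graph.sub_mem (h.mem_graph_c a) (h.mem_graph_c (C a))
  have h2 : (C a - C (C a), Z (W a) - Z (W (C a))) ∈ adjointGraph (adjointOp T) := by
    rw [← graph_adjointOp _ (dense_domain_adjointOp hdense hclosed),
      adjointOp_adjointOp hdense hclosed]
    exact h1
  have h3 : (Z (W (C a)), C a - C (C a)) ∈ (adjointOp T).graph := by
    rw [graph_adjointOp T hdense]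
    exact h.mem_adjointGraph_c hdense (C a)
  have h4 := eq_of_cOp_eq (dense_domain_adjointOp hdense hclosed) h'.cOp_eq h3 h2
  rw [add_sub_cancel] at h4
  rw [h4, ← h.sqrt_sqrt, ← h.sqrt_sqrt a]

/-- `C_{T*}^{1/2} Z_T = Z_T C_T^{1/2}`. -/
theorem apply_sqrt (h : IsBoundedTransform T C W Z)
    (h' : IsBoundedTransform (adjointOp T) C' W' Z') (hdense : Dense (T.domain : Set H))
    (hclosed : IsClosedOp T) (x : H) : Z (W x) = W' (Z x) := by
  have := ((toComplex Z).restrictScalars ℝ).map_sqrt_of_intertwines h.nonneg h.norm_le_one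
    h'.nonneg h'.norm_le_one (h.apply_c h' hdense hclosed) x
  rw [← h.toComplex_eq_sqrt, ← h'.toComplex_eq_sqrt] at this
  exact this

/-- `(Z_T)* = Z_{T*}`. On the dense range of `W'` this reads `W Z_T* = T* C_{T*}`, where the
left-hand side is the adjoint of `Z_T W = T C_T`. -/
theorem adjoint_apply (h : IsBoundedTransform T C W Z)
    (h' : IsBoundedTransform (adjointOp T) C' W' Z') (hdense : Dense (T.domain : Set H))
    (hclosed : IsClosedOp T) (x : H) : (toComplex Z).adjoint x = Z' x := by
  have hdense' := dense_domain_adjointOp hdense hclosed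
  refine congr_fun (DenseRange.equalizer (h'.denseRange_sqrt hdense')
    (g := fun x => (toComplex Z).adjoint x) (h := fun x => Z' x)
    (by fun_prop) (by fun_prop) (funext fun a => ?_)) x
  refine ext_inner_right ℂ fun z => ?_
  change inner ℂ ((toComplex Z).adjoint (W' a)) z = inner ℂ (Z' (W' a)) z
  rw [adjoint_inner_left, toComplex_apply, h'.inner_sqrt_left,
    ← h.apply_sqrt h' hdense hclosed]
  have h1 := h'.mem_graph_c a
  rw [graph_adjointOp T hdense] at h1
  have h2 := h'.mem_adjointGraph_c hdense' a
  rw [← graph_adjointOp _ hdense', adjointOp_adjointOp hdense hclosed] at h2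
  -- with `t = T* C' a` and `s = T t` one has `a = C' a + s`
  have h3 := mem_adjointGraph_iff.mp h1 _ _ (h.mem_graph_c z)
  have h4 := mem_adjointGraph_iff.mp (h.mem_adjointGraph_c hdense z) _ _ h2
  rw [← inner_conj_symm, ← inner_conj_symm (z - C z), (starRingEnd ℂ).injective.eq_iff] at h4
  rw [inner_sub_left, inner_sub_right, h3, sub_eq_sub_iff_add_eq_add] at h4
  exact add_right_cancel h4

theorem adjointOp_zOp (h : IsBoundedTransform T C W Z)
    (h' : IsBoundedTransform (adjointOp T) C' W' Z') (hdense : Dense (T.domain : Set H))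
    (hclosed : IsClosedOp T) : adjointOp (zOp T) = zOp (adjointOp T) := by
  rw [h.zOp_eq, h'.zOp_eq]
  refine linearPMap_ext_graph fun x y => ?_
  rw [mem_graph_adjointOp_toOp, mem_graph_toOp, h.adjoint_apply h' hdense hclosed]

/-- For normal `T` the operators `C_T` and `C_{T*}` agree, hence so do `Z_T* Z_T = I - C_T` and
`Z_T Z_T* = I - C_{T*}`. -/
theorem isNormalOp_zOp (h : IsBoundedTransform T C W Z)
    (h' : IsBoundedTransform (adjointOp T) C' W' Z') (hT : IsNormalOp T) :
    IsNormalOp (zOp T) := by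
  obtain ⟨hdense, hclosed, hcomm⟩ := hT
  have hdense' := dense_domain_adjointOp hdense hclosed
  have hTT := adjointOp_adjointOp hdense hclosed
  have hCC : C' = C := toOp_injective (by
    rw [← h'.cOp_eq, ← h.cOp_eq, cOp, cOp, oneAddAdjointMul, oneAddAdjointMul, hTT, hcomm])
  refine ⟨?_, ?_, ?_⟩
  · rw [h.zOp_eq]; exact dense_univ
  · rw [h.zOp_eq]; exact isClosedOp_toOp Z
  · have h1 := h'.mulOp_adjointOp_zOp hdense'
    have h2 := (hTT.symm ▸ h : IsBoundedTransform (adjointOp (adjointOp T)) C W Z)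
    rw [h'.adjointOp_zOp h2 hdense' (isClosedOp_adjointOp hdense), hTT] at h1
    rw [h.mulOp_adjointOp_zOp hdense, h.adjointOp_zOp h' hdense hclosed, h1, hCC]

end IsBoundedTransform

end QuaternionicOp

theorem mainTheorem3 {H : Type*} [NormedAddCommGroup H] [RightQuaternionicInnerProductSpace H]
    [CompleteSpace H] (T : H →ₗ.[ℍᵐᵒᵖ] H) (hdense : Dense (T.domain : Set H))
    (hclosed : QuaternionicOp.IsClosedOp T) :
    -- the operators `C_T`, `C_T^{1/2}`, `T*` are well defined and behave as their notation says
    (Function.Injective (QuaternionicOp.oneAddAdjointMul T).toFun ∧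
      QuaternionicOp.IsBoundedOp (QuaternionicOp.cOp T) ∧
      QuaternionicOp.IsPositiveOp (QuaternionicOp.cOp T) ∧
      (∃! W : H →ₗ.[ℍᵐᵒᵖ] H, QuaternionicOp.IsPositiveSqrt (QuaternionicOp.cOp T) W) ∧
      Dense ((QuaternionicOp.adjointOp T).domain : Set H) ∧
      QuaternionicOp.IsClosedOp (QuaternionicOp.adjointOp T)) ∧
    -- (i)
    (QuaternionicOp.IsBoundedOp (QuaternionicOp.zOp T) ∧
      QuaternionicOp.normOp (QuaternionicOp.zOp T) ≤ 1 ∧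
      QuaternionicOp.cOp T =
        QuaternionicOp.idOp - QuaternionicOp.mulOp
          (QuaternionicOp.adjointOp (QuaternionicOp.zOp T)) (QuaternionicOp.zOp T)) ∧
    -- (ii)
    QuaternionicOp.adjointOp (QuaternionicOp.zOp T) =
      QuaternionicOp.zOp (QuaternionicOp.adjointOp T) ∧
    -- (iii)
    (QuaternionicOp.IsNormalOp T → QuaternionicOp.IsNormalOp (QuaternionicOp.zOp T)) := by
  have hdense' := QuaternionicOp.dense_domain_adjointOp hdense hclosed
  have hclosed' := QuaternionicOp.isClosedOp_adjointOp hdense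
  obtain ⟨C, W, Z, h⟩ := QuaternionicOp.exists_isBoundedTransform hdense hclosed
  obtain ⟨C', W', Z', h'⟩ := QuaternionicOp.exists_isBoundedTransform hdense' hclosed'
  refine ⟨⟨LinearMap.ker_eq_bot.mp (QuaternionicOp.ker_oneAddAdjointMul hdense), ?_, ?_, ?_,
    hdense', hclosed'⟩, ⟨?_, ?_, ?_⟩, h.adjointOp_zOp h' hdense hclosed, h.isNormalOp_zOp h'⟩
  · rw [h.cOp_eq]
    exact QuaternionicOp.isBoundedOp_toOp C
  · rw [h.cOp_eq]
    exact QuaternionicOp.isPositiveOp_toOp_iff.mpr h.nonneg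
  · rw [h.cOp_eq]
    exact ⟨_, h.isPositiveSqrt,
      fun V hV => QuaternionicOp.eq_toOp_of_isPositiveSqrt h.toComplex_eq_sqrt hV⟩
  · rw [h.zOp_eq]
    exact QuaternionicOp.isBoundedOp_toOp Z
  · rw [h.zOp_eq]
    refine csSup_le ⟨_, 0, by simp, rfl⟩ ?_
    rintro _ ⟨x, hx, rfl⟩
    exact (h.norm_apply_le hdense x).trans hx
  · rw [h.mulOp_adjointOp_zOp hdense, h.cOp_eq, QuaternionicOp.idOp_eq, QuaternionicOp.toOp_sub,
      sub_sub_cancel]
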